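/- For integers $0\le m\le n$ the permanent of an $m\times n$ real matrix $A=(a_{ij})$ is $\operatorname{perm}A=\sum_{\pi}\prod_{i=1}^{m}a_{i,\pi(i)}$, the sum running over all one-to-one functions $\pi\colon\{1,\dots,m\}\to\{1,\dots,n\}$. \textbf{Theorem.} Let $\xi$ be an (almost surely) positive random variable satisfying $$\lim_{t\to\infty}\frac{\log \mathbb P(\xi\ge t)}{\log t}=-\frac1\beta$$ for some real $\beta>0$. Let $(m_n)$ be a sequence of nonnegative integers with $m_n\le n$ and $$\liminf_{n\to\infty}\frac{m_n\log\log n}{(\log n)^2}>1$$ (the lower limit may be $+\infty$). Let $(A_n)$ be a sequence of random matrices on a common probability space such that, for each $n$, $A_n$ is an $m_n\times n$ matrix whose entries are independent and distributed as $\xi$ (nothing is assumed on the dependence between $A_n$ and $A_{n'}$ for $n\ne n'$). Then almost surely $$\lim_{n\to\infty}\frac{\log\operatorname{perm}A_n}{m_n\log n}=\max(1,\beta).$$ -/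

import Mathlib

open MeasureTheory ProbabilityTheory Filter Topology

/-- The permanent of an `m × n` matrix (meant for `m ≤ n`): the sum over all one-to-one functions
`π` from the rows to the columns of the products `∏ i, a (i, π i)`. -/
noncomputable def rectPermanent {m n : ℕ} (A : Matrix (Fin m) (Fin n) ℝ) : ℝ :=
  ∑ π : Fin m ↪ Fin n, ∏ i : Fin m, A i (π i)

/-! Upper bound: for `1/b < s < 1/max(1,β)`, `ξ` has a finite `s`-th moment `K` and `x ↦ x^s` is
subadditive, so Markov's inequality gives `P(perm ≥ n^(bm)) ≤ (K n^(1-bs))^m`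
(`rpow_mul_measure_le_rectPermanent`).

Lower bound: keep the first `l ≈ (1-ε)m` rows. Almost surely, for large `n`, every row and column
has few entries below a small constant `c`, so every injection of these `l` rows extends to all rows
through entries `≥ c` (`rectPermanent_ge_of_few_small`); the other rows cost only a factor
`c^(m-l)`. Since `n - l ≥ εn`, the `l` rows have room for two estimates. Counting injections through
entries `≥ c` gives order `(const · n)^l`, hence exponent `1` (`rectPermanent_ge_of_many_large`).
Hall's theorem yields one injection through entries `≥ n^b` for any `0 < b < β`, hence exponent `β`
(`rectPermanent_ge_of_hall`, `measureReal_not_hall_le`).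

The growth of `m` enters only through `log n ≤ m n`, which turns `e^(-Cm)` into `n^(-C)`, summable
for Borel–Cantelli. -/

/-! ### Deterministic lower bounds for permanents -/

/-- Hall's condition between the remaining rows and the unused columns: a single row already has `k`
good unused columns, which serves sets of at most `k` rows, while a set of more than `k` rows
reaches every unused column. -/
theorem exists_extension_of_few_nonneighbours {ι α β : Type*} [Fintype ι] [Fintype α] [Fintype β]
    [DecidableEq α] [DecidableEq β] (B : α → β → Prop) [∀ i j, Decidable (B i j)]
    (e : ι ↪ α) (σ : ι ↪ β) {r k : ℕ}
    (hrow : ∀ i, (Finset.univ.filter fun j => ¬ B i j).card ≤ r)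
    (hcol : ∀ j, (Finset.univ.filter fun i => ¬ B i j).card ≤ k)
    (hcard : Fintype.card α ≤ Fintype.card β)
    (h : k + r + Fintype.card ι ≤ Fintype.card β) :
    ∃ π : α ↪ β, (∀ i, π (e i) = σ i) ∧ ∀ i, (∀ x, e x ≠ i) → B i (π i) := by
  classical
  let U : Finset β := (Finset.univ.map σ)ᶜ
  have hU : U.card = Fintype.card β - Fintype.card ι := by
    simp [U, Finset.card_compl]
  let t : {i : α // ∀ x, e x ≠ i} → Finset β := fun i => U.filter fun j => B i j
  have hall : ∀ s : Finset {i : α // ∀ x, e x ≠ i}, s.card ≤ (s.biUnion t).card := by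
    intro s
    rcases s.eq_empty_or_nonempty with rfl | ⟨i, hi⟩
    · simp
    by_cases hs : s.card ≤ k
    · have h1 : U.card ≤ (t i).card + r := by
        have := Finset.card_filter_add_card_filter_not (s := U) (fun j => B i j)
        have h2 : (U.filter fun j => ¬ B i j).card ≤ r :=
          (Finset.card_le_card (Finset.filter_subset_filter _ (Finset.subset_univ _))).trans
            (hrow i)
        simp only [t]
        omega
      have h3 : (t i).card ≤ (s.biUnion t).card :=
        Finset.card_le_card (Finset.subset_biUnion_of_mem t hi)
      omega
    · have h1 : s.biUnion t = U := by
        apply Finset.Subset.antisymm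
        · intro j hj
          simp only [t, Finset.mem_biUnion, Finset.mem_filter] at hj
          obtain ⟨_, _, hj, _⟩ := hj
          exact hj
        · intro j hj
          by_contra hcon
          apply hs
          refine le_trans ?_ (hcol j)
          rw [← Finset.card_map (Function.Embedding.subtype _)]
          apply Finset.card_le_card
          intro x hx
          simp only [Finset.mem_map] at hx
          obtain ⟨y, hy, rfl⟩ := hx
          simp only [Finset.mem_filter, Finset.mem_univ, true_and]
          intro hB
          exact hcon (Finset.mem_biUnion.2 ⟨y, hy, Finset.mem_filter.2 ⟨hj, hB⟩⟩)
      rw [h1, hU]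
      have h2 : s.card ≤ Fintype.card {i : α // ∀ x, e x ≠ i} := Finset.card_le_univ _
      have h3 : Fintype.card {i : α // ∀ x, e x ≠ i} = Fintype.card α - Fintype.card ι := by
        rw [Fintype.card_subtype]
        have : (Finset.univ.filter fun i : α => ∀ x, e x ≠ i) = (Finset.univ.map e)ᶜ := by
          ext i; simp
        rw [this, Finset.card_compl]; simp
      omega
  obtain ⟨f, hf, hft⟩ := (Finset.all_card_le_biUnion_card_iff_exists_injective t).1 hall
  have hft' : ∀ i, (∀ x, σ x ≠ f i) ∧ B i (f i) := by
    intro i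
    have := hft i
    simpa [t, U] using this
  let π : α → β := fun i => if h : ∃ x, e x = i then σ h.choose else f ⟨i, by simpa using h⟩
  have hπ1 : ∀ x, π (e x) = σ x := by
    intro x
    have hx : ∃ y, e y = e x := ⟨x, rfl⟩
    simp only [π, dif_pos hx]
    exact congrArg σ (e.injective hx.choose_spec)
  have hπ2 : ∀ i (h : ∀ x, e x ≠ i), π i = f ⟨i, h⟩ := by
    intro i h
    have : ¬ ∃ x, e x = i := by simpa using h
    simp only [π, dif_neg this]
  refine ⟨⟨π, ?_⟩, hπ1, fun i hi => ?_⟩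
  · intro a b hab
    by_cases ha : ∃ x, e x = a <;> by_cases hb : ∃ x, e x = b
    · obtain ⟨x, rfl⟩ := ha
      obtain ⟨y, rfl⟩ := hb
      rw [hπ1, hπ1] at hab
      rw [σ.injective hab]
    · obtain ⟨x, rfl⟩ := ha
      rw [hπ1, hπ2 b (by simpa using hb)] at hab
      exact absurd hab ((hft' _).1 x)
    · obtain ⟨x, rfl⟩ := hb
      rw [hπ1, hπ2 a (by simpa using ha)] at hab
      exact absurd hab.symm ((hft' _).1 x)
    · rw [hπ2 a (by simpa using ha), hπ2 b (by simpa using hb)] at hab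
      exact congrArg Subtype.val (hf hab)
  · change B i (π i)
    rw [hπ2 i hi]
    exact (hft' ⟨i, hi⟩).2

/-- Extending injections is itself injective, since restriction recovers the original, so distinct
terms of the small permanent are charged to distinct terms of the large one. -/
theorem rectPermanent_ge_of_few_small {l m n : ℕ} (hlm : l ≤ m) (hmn : m ≤ n)
    {A : Matrix (Fin m) (Fin n) ℝ} (hA : ∀ i j, 0 ≤ A i j) {c : ℝ} (hc : 0 ≤ c) {r k : ℕ}
    (hrow : ∀ i, (Finset.univ.filter fun j => A i j < c).card ≤ r)
    (hcol : ∀ j, (Finset.univ.filter fun i => A i j < c).card ≤ k)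
    (h : k + r + l ≤ n) :
    c ^ (m - l) * rectPermanent (A.submatrix (Fin.castLE hlm) id) ≤ rectPermanent A := by
  classical
  have key := fun σ : Fin l ↪ Fin n =>
    exists_extension_of_few_nonneighbours (fun i j => c ≤ A i j) (Fin.castLEEmb hlm) σ
      (r := r) (k := k) (by simpa using hrow) (by simpa using hcol) (by simpa using hmn)
      (by simpa using h)
  choose π hπ1 hπ2 using key
  have hinj : Function.Injective π := by
    intro σ τ hst
    ext i
    rw [← hπ1 σ i, ← hπ1 τ i, hst]
  unfold rectPermanent
  calc c ^ (m - l) * ∑ σ : Fin l ↪ Fin n, ∏ i, A.submatrix (Fin.castLE hlm) id i (σ i)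
      = ∑ σ : Fin l ↪ Fin n, c ^ (m - l) * ∏ i, A (Fin.castLE hlm i) (σ i) := by
        rw [Finset.mul_sum]; rfl
    _ ≤ ∑ σ : Fin l ↪ Fin n, ∏ i, A i (π σ i) := by
        apply Finset.sum_le_sum
        intro σ _
        let R : Finset (Fin m) := Finset.univ.map (Fin.castLEEmb hlm)
        rw [← Finset.prod_compl_mul_prod R]
        have h1 : ∏ i ∈ R, A i (π σ i) = ∏ i, A (Fin.castLE hlm i) (σ i) := by
          simp only [R, Finset.prod_map]
          refine Finset.prod_congr rfl fun i _ => ?_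
          rw [hπ1]; rfl
        have h2 : c ^ (m - l) = ∏ _i ∈ Rᶜ, c := by
          simp [R, Finset.card_compl]
        rw [h1, h2]
        apply mul_le_mul_of_nonneg_right
        · apply Finset.prod_le_prod
          · intros; exact hc
          · intro i hi
            apply hπ2
            simpa [R] using hi
        · exact Finset.prod_nonneg fun _ _ => hA _ _
    _ = ∑ π' ∈ Finset.univ.map ⟨π, hinj⟩, ∏ i, A i (π' i) := by
        rw [Finset.sum_map]; rfl
    _ ≤ ∑ π' : Fin m ↪ Fin n, ∏ i, A i (π' i) :=
        Finset.sum_le_sum_of_subset_of_nonneg (Finset.subset_univ _)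
          fun _ _ _ => Finset.prod_nonneg fun _ _ => hA _ _

/-- Expand along one row: however the other rows are placed, at least `d` of its large entries lie
in free columns. -/
theorem rectPermanent_ge_of_many_large {l n d : ℕ} {A : Matrix (Fin l) (Fin n) ℝ}
    (hA : ∀ i j, 0 ≤ A i j) {c : ℝ} (hc : 0 ≤ c)
    (hrow : ∀ i, d + l ≤ (Finset.univ.filter fun j => c ≤ A i j).card) :
    (d * c) ^ l ≤ rectPermanent A := by
  classical
  induction l with
  | zero => simp [rectPermanent]
  | succ l ih =>
    have ih' := ih (A := A.submatrix Fin.succ id) (fun i j => hA _ _) (fun i => by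
      exact le_trans (by omega) (hrow i.succ))
    have hsum : rectPermanent A = ∑ e : Fin l ↪ Fin n,
        ∑ j : {j // j ∉ Set.range e}, A 0 j * ∏ i : Fin l, A i.succ (e i) := by
      rw [rectPermanent, ← (Equiv.embeddingFinSucc l (Fin n)).symm.sum_comp, Fintype.sum_sigma]
      refine Finset.sum_congr rfl fun e _ => ?_
      refine Finset.sum_congr rfl fun x _ => ?_
      rw [Fin.prod_univ_succ]
      simp
    rw [hsum, pow_succ]
    calc (d * c) ^ l * (d * c) ≤ rectPermanent (A.submatrix Fin.succ id) * (d * c) :=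
          mul_le_mul_of_nonneg_right ih' (by positivity)
      _ = ∑ e : Fin l ↪ Fin n, (d * c) * ∏ i : Fin l, A i.succ (e i) := by
          rw [rectPermanent, Finset.sum_mul]
          exact Finset.sum_congr rfl fun _ _ => mul_comm _ _
      _ ≤ _ := by
          apply Finset.sum_le_sum
          intro e _
          rw [← Finset.sum_mul]
          apply mul_le_mul_of_nonneg_right _ (Finset.prod_nonneg fun _ _ => hA _ _)
          let T : Finset (Fin n) := Finset.univ.filter fun j => c ≤ A 0 j
          let V : Finset (Fin n) := T \ Finset.univ.map e
          have hV : d ≤ V.card := by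
            have h1 := Finset.le_card_sdiff (Finset.univ.map e) T
            have h2 := hrow 0
            simp only [Finset.card_map, Finset.card_univ, Fintype.card_fin] at h1
            simp only [V, T] at *
            omega
          have h3 : ∑ j : {j // j ∉ Set.range e}, A 0 j
              = ∑ j ∈ Finset.univ.filter (fun j => j ∉ Set.range e), A 0 j :=
            (Finset.sum_subtype _ (by simp) _).symm
          rw [h3]
          calc (d : ℝ) * c ≤ V.card * c := by gcongr
            _ = ∑ _j ∈ V, c := by simp
            _ ≤ ∑ j ∈ V, A 0 j := by
                apply Finset.sum_le_sum
                intro j hj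
                simp only [V, T, Finset.mem_sdiff, Finset.mem_filter] at hj
                exact hj.1.2
            _ ≤ _ := by
                apply Finset.sum_le_sum_of_subset_of_nonneg
                · intro j hj
                  simpa [V, T] using (Finset.mem_sdiff.1 hj).2
                · intros; exact hA _ _

theorem rectPermanent_ge_of_hall {l n : ℕ} {A : Matrix (Fin l) (Fin n) ℝ}
    (hA : ∀ i j, 0 ≤ A i j) {t : ℝ} (ht : 0 ≤ t)
    (hall : ∀ (S : Finset (Fin l)) (T : Finset (Fin n)), S.Nonempty → T.card + S.card = n + 1 →
      ∃ i ∈ S, ∃ j ∈ T, t ≤ A i j) :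
    t ^ l ≤ rectPermanent A := by
  classical
  let N : Fin l → Finset (Fin n) := fun i => Finset.univ.filter fun j => t ≤ A i j
  have hN : ∀ S : Finset (Fin l), S.card ≤ (S.biUnion N).card := by
    intro S
    by_contra! hlt
    have hne : S.Nonempty := Finset.card_pos.1 (by omega)
    have hSn : n + 1 - S.card ≤ ((S.biUnion N)ᶜ).card := by
      rw [Finset.card_compl, Fintype.card_fin]; omega
    obtain ⟨T, hT, hTc⟩ := Finset.exists_subset_card_eq hSn
    by_cases hS : S.card ≤ n + 1
    · obtain ⟨i, hi, j, hj, hij⟩ := hall S T hne (by omega)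
      have := hT hj
      rw [Finset.mem_compl] at this
      exact this (Finset.mem_biUnion.2 ⟨i, hi, by simpa [N] using hij⟩)
    · obtain ⟨S', hS', hSc⟩ := Finset.exists_subset_card_eq (n := n + 1) (s := S) (by omega)
      obtain ⟨i, hi, j, hj, hij⟩ := hall S' ∅ (Finset.card_pos.1 (by omega)) (by simp [hSc])
      simp at hj
  obtain ⟨f, hf, hfN⟩ := (Finset.all_card_le_biUnion_card_iff_exists_injective N).1 hN
  have h1 : ∏ _i : Fin l, t ≤ ∏ i, A i (f i) :=
    Finset.prod_le_prod (fun _ _ => ht) fun i _ => by simpa [N] using hfN i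
  calc t ^ l = ∏ _i : Fin l, t := by simp
    _ ≤ ∏ i, A i ((⟨f, hf⟩ : Fin l ↪ Fin n) i) := h1
    _ ≤ _ := Finset.single_le_sum (f := fun π : Fin l ↪ Fin n => ∏ i, A i (π i))
        (fun _ _ => Finset.prod_nonneg fun _ _ => hA _ _) (Finset.mem_univ _)

/-! ### Borel–Cantelli, tails and fractional moments -/

theorem ae_eventually_notMem_of_le_inv_sq {Ω : Type*} [MeasurableSpace Ω] {P : Measure Ω}
    [IsFiniteMeasure P] {s : ℕ → Set Ω} {C : ℝ}
    (h : ∀ᶠ n : ℕ in atTop, P.real (s n) ≤ C * ((n : ℝ) ^ 2)⁻¹) :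
    ∀ᵐ ω ∂P, ∀ᶠ n in atTop, ω ∉ s n := by
  apply ae_eventually_notMem
  have hsum : Summable fun n => P.real (s n) := by
    refine Summable.of_norm_bounded_eventually_nat
      ((Real.summable_nat_pow_inv.2 (by norm_num : 1 < 2)).mul_left C) ?_
    filter_upwards [h] with n hn
    rwa [Real.norm_of_nonneg measureReal_nonneg]
  have h1 : ∀ n, P (s n) = ENNReal.ofReal (P.real (s n)) := fun n => (ofReal_measureReal).symm
  simp_rw [h1]
  exact hsum.tsum_ofReal_ne_top

theorem eventually_le_rpow_of_tendsto_log_div_log {p : ℝ → ℝ} (hp : ∀ t, 0 ≤ p t) {a r : ℝ}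
    (h : Tendsto (fun t => Real.log (p t) / Real.log t) atTop (𝓝 a)) (hr : a < r) :
    ∀ᶠ t in atTop, p t ≤ t ^ r := by
  filter_upwards [h.eventually_lt_const hr, eventually_gt_atTop 1] with t ht h1
  have hlog := Real.log_pos h1
  rw [div_lt_iff₀ hlog] at ht
  rcases (hp t).eq_or_lt with h0 | h0
  · rw [← h0]; positivity
  · exact (Real.log_le_log_iff h0 (by positivity)).1
      (by rw [Real.log_rpow (by linarith)]; exact ht.le)

theorem eventually_rpow_le_of_tendsto_log_div_log {p : ℝ → ℝ} (hp : ∀ t, 0 ≤ p t) {a r : ℝ}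
    (h : Tendsto (fun t => Real.log (p t) / Real.log t) atTop (𝓝 a)) (hr : r < a) (ha : a < 0) :
    ∀ᶠ t in atTop, t ^ r ≤ p t := by
  filter_upwards [h.eventually_const_lt hr, h.eventually_lt_const ha, eventually_gt_atTop 1]
    with t ht h0 h1
  have hlog := Real.log_pos h1
  rw [lt_div_iff₀ hlog] at ht
  -- With the convention `log 0 = 0`, a vanishing tail would make the quotient `0`, which `a < 0`
  -- excludes.
  have hpos : 0 < p t := by
    refine (hp t).lt_of_ne fun h => ?_
    simp [← h] at h0
  exact (Real.log_le_log_iff (by positivity) hpos).1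
      (by rw [Real.log_rpow (by linarith)]; exact ht.le)

/-- Layer-cake formula: the integrand is at most `t^(s-1)` near `0` and `t^(s-r-1)` near infinity,
both integrable because `0 < s < r`. -/
theorem lintegral_rpow_lt_top_of_tail {Ω : Type*} [MeasurableSpace Ω] {P : Measure Ω}
    [IsProbabilityMeasure P] {ξ : Ω → ℝ} (hξ : AEMeasurable ξ P) (hpos : ∀ᵐ ω ∂P, 0 < ξ ω)
    {r s : ℝ} (hs : 0 < s) (hsr : s < r)
    (htail : ∀ᶠ t in atTop, P.real {ω | t ≤ ξ ω} ≤ t ^ (-r)) :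
    ∫⁻ ω, ENNReal.ofReal (ξ ω ^ s) ∂P < ⊤ := by
  rw [lintegral_rpow_eq_lintegral_meas_le_mul P (hpos.mono fun _ h => h.le) hξ hs]
  refine ENNReal.mul_lt_top ENNReal.ofReal_lt_top ?_
  obtain ⟨t₀, ht₀⟩ := eventually_atTop.1 htail
  set T := max t₀ 1 with hT
  have hT0 : 0 < T := by positivity
  rw [← Set.Ioc_union_Ioi_eq_Ioi hT0.le,
    lintegral_union measurableSet_Ioi (Set.Ioc_disjoint_Ioi le_rfl)]
  refine ENNReal.add_lt_top.2 ⟨?_, ?_⟩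
  · have hint : IntegrableOn (fun t : ℝ => t ^ (s - 1)) (Set.Ioc 0 T) :=
      (intervalIntegrable_iff_integrableOn_Ioc_of_le hT0.le).1
        (intervalIntegral.intervalIntegrable_rpow' (by linarith))
    refine lt_of_le_of_lt (lintegral_mono fun t => ?_) hint.lintegral_lt_top
    exact mul_le_of_le_one_left (by positivity) prob_le_one
  · have hint : IntegrableOn (fun t : ℝ => t ^ (s - r - 1)) (Set.Ioi T) :=
      integrableOn_Ioi_rpow_of_lt (by linarith) hT0
    refine lt_of_le_of_lt (setLIntegral_mono' measurableSet_Ioi fun t ht => ?_)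
      hint.lintegral_lt_top
    have ht0 : 0 < t := hT0.trans ht
    rw [← ofReal_measureReal (μ := P), ← ENNReal.ofReal_mul measureReal_nonneg]
    apply ENNReal.ofReal_le_ofReal
    calc P.real {ω | t ≤ ξ ω} * t ^ (s - 1) ≤ t ^ (-r) * t ^ (s - 1) := by
          gcongr
          exact ht₀ t ((le_max_left _ _).trans (le_of_lt ht))
      _ = t ^ (s - r - 1) := by rw [← Real.rpow_add ht0]; ring_nf

theorem lintegral_prod_comp_of_iIndepFun {Ω ι : Type*} [MeasurableSpace Ω] {P : Measure Ω}
    [Fintype ι] {X : ι → Ω → ℝ} (hX : iIndepFun X P) (hm : ∀ i, AEMeasurable (X i) P)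
    {g : ℝ → ENNReal} (hg : Measurable g) :
    ∫⁻ ω, ∏ i, g (X i ω) ∂P = ∏ i, ∫⁻ ω, g (X i ω) ∂P := by
  have h1 : iIndepFun (fun i => (hm i).mk) P := hX.congr fun i => (hm i).ae_eq_mk
  have h2 := lintegral_prod_eq_prod_lintegral_of_indepFun Finset.univ
    (fun i ω => g ((hm i).mk _ ω)) (h1.comp (fun _ => g) fun _ => hg)
    (fun i => hg.comp (hm i).measurable_mk)
  have h3 : ∀ᵐ ω ∂P, ∀ i, X i ω = (hm i).mk _ ω := ae_all_iff.2 fun i => (hm i).ae_eq_mk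
  calc _ = ∫⁻ ω, ∏ i, g ((hm i).mk _ ω) ∂P :=
        lintegral_congr_ae (h3.mono fun ω h => by simp only [h])
    _ = _ := h2
    _ = _ := Finset.prod_congr rfl fun i _ =>
        lintegral_congr_ae (h3.mono fun ω h => by simp only [h])

theorem ENNReal.rpow_sum_le_sum_rpow {ι : Type*} (S : Finset ι) (f : ι → ENNReal) {s : ℝ}
    (hs : 0 < s) (hs1 : s ≤ 1) : (∑ i ∈ S, f i) ^ s ≤ ∑ i ∈ S, f i ^ s := by
  classical
  induction S using Finset.induction_on with
  | empty => simp [hs]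
  | insert a S ha ih =>
    rw [Finset.sum_insert ha, Finset.sum_insert ha]
    exact (ENNReal.rpow_add_le_add_rpow _ _ hs.le hs1).trans (by gcongr)

/-- Subadditivity bounds `perm^s` by at most `n^m` products, each of mean `K^m` by independence;
Markov's inequality finishes. -/
theorem rpow_mul_measure_le_rectPermanent {Ω : Type*} [MeasurableSpace Ω] {P : Measure Ω}
    {m n : ℕ} {A : Ω → Matrix (Fin m) (Fin n) ℝ}
    (hind : iIndepFun (fun (p : Fin m × Fin n) ω => A ω p.1 p.2) P)
    (hmeas : ∀ i j, AEMeasurable (fun ω => A ω i j) P)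
    (hpos : ∀ᵐ ω ∂P, ∀ i j, 0 ≤ A ω i j) {s : ℝ} (hs : 0 < s) (hs1 : s ≤ 1) {K : ENNReal}
    (hK : ∀ i j, ∫⁻ ω, ENNReal.ofReal (A ω i j) ^ s ∂P = K) (y : ℝ) :
    ENNReal.ofReal y ^ s * P {ω | y ≤ rectPermanent (A ω)} ≤ (n * K) ^ m := by
  let f : Ω → ENNReal := fun ω => ∑ π : Fin m ↪ Fin n, ∏ i, ENNReal.ofReal (A ω i (π i)) ^ s
  have hg : Measurable fun x : ℝ => ENNReal.ofReal x ^ s :=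
    ENNReal.measurable_ofReal.pow_const s
  have hterm : ∀ π : Fin m ↪ Fin n,
      AEMeasurable (fun ω => ∏ i, ENNReal.ofReal (A ω i (π i)) ^ s) P := fun π =>
    Finset.aemeasurable_fun_prod _ fun i _ => hg.comp_aemeasurable (hmeas i (π i))
  have hf : AEMeasurable f P := Finset.aemeasurable_fun_sum _ fun π _ => hterm π
  have hint : ∫⁻ ω, f ω ∂P ≤ (n * K) ^ m := by
    simp only [f]
    rw [lintegral_finsetSum' _ fun π _ => hterm π]
    have h1 : ∀ π : Fin m ↪ Fin n,
        ∫⁻ ω, ∏ i, ENNReal.ofReal (A ω i (π i)) ^ s ∂P = K ^ m := by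
      intro π
      have hinj : Function.Injective fun i : Fin m => (i, π i) := fun a b h =>
        (Prod.mk.inj h).1
      rw [lintegral_prod_comp_of_iIndepFun (hind.precomp hinj) (fun i => hmeas i (π i)) hg]
      simp [hK]
    simp only [h1, Finset.sum_const, Finset.card_univ, nsmul_eq_mul, mul_pow]
    gcongr
    have : Fintype.card (Fin m ↪ Fin n) ≤ n ^ m := by
      simpa [Fintype.card_embedding_eq] using Nat.descFactorial_le_pow n m
    exact_mod_cast this
  refine le_trans ?_ ((mul_meas_ge_le_lintegral₀ hf (ENNReal.ofReal y ^ s)).trans hint)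
  refine mul_le_mul' le_rfl (measure_mono_ae ?_)
  filter_upwards [hpos] with ω hω hy
  change ENNReal.ofReal y ^ s ≤ f ω
  calc ENNReal.ofReal y ^ s ≤ ENNReal.ofReal (rectPermanent (A ω)) ^ s := by
        gcongr
        exact hy
    _ = (∑ π : Fin m ↪ Fin n, ∏ i, ENNReal.ofReal (A ω i (π i))) ^ s := by
        rw [rectPermanent, ENNReal.ofReal_sum_of_nonneg
          fun _ _ => Finset.prod_nonneg fun _ _ => hω _ _]
        simp_rw [ENNReal.ofReal_prod_of_nonneg fun (i : Fin m) (_ : i ∈ Finset.univ) => hω i _]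
    _ ≤ ∑ π : Fin m ↪ Fin n, (∏ i, ENNReal.ofReal (A ω i (π i))) ^ s :=
        ENNReal.rpow_sum_le_sum_rpow _ _ hs hs1
    _ = f ω := by
        simp only [f]
        refine Finset.sum_congr rfl fun π _ => ?_
        rw [ENNReal.prod_rpow_of_nonneg hs.le]

/-! ### Union bounds for small entries -/

theorem measureReal_forall_mem_lt_le {Ω ι : Type*} [MeasurableSpace Ω] {P : Measure Ω}
    {X : ι → Ω → ℝ} (hX : iIndepFun X P) {c q : ℝ}
    (hq : ∀ i, P.real {ω | X i ω < c} ≤ q) (T : Finset ι) :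
    P.real {ω | ∀ i ∈ T, X i ω < c} ≤ q ^ T.card := by
  have h := hX.measure_inter_preimage_eq_mul T (sets := fun _ => Set.Iio c)
    fun _ _ => measurableSet_Iio
  have h1 : {ω | ∀ i ∈ T, X i ω < c} = ⋂ i ∈ T, X i ⁻¹' Set.Iio c := by
    ext ω; simp
  rw [h1, measureReal_def, h, ENNReal.toReal_prod]
  exact (Finset.prod_le_prod (fun _ _ => measureReal_nonneg) fun i _ => hq i).trans (by simp)

theorem measureReal_card_lt_gt_le {Ω ι : Type*} [MeasurableSpace Ω] {P : Measure Ω} [Fintype ι]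
    {X : ι → Ω → ℝ} (hX : iIndepFun X P) {c q : ℝ}
    (hq0 : 0 ≤ q) (hq : ∀ i, P.real {ω | X i ω < c} ≤ q) (k : ℕ) :
    P.real {ω | k < (Finset.univ.filter fun i => X i ω < c).card}
      ≤ 2 ^ Fintype.card ι * q ^ (k + 1) := by
  classical
  have := hX.isProbabilityMeasure
  have hsub : {ω | k < (Finset.univ.filter fun i => X i ω < c).card} ⊆
      ⋃ T ∈ Finset.powersetCard (k + 1) (Finset.univ : Finset ι),
        {ω | ∀ i ∈ T, X i ω < c} := by
    intro ω hω
    obtain ⟨T, hT, hTc⟩ := Finset.exists_subset_card_eq (Nat.succ_le_of_lt hω)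
    refine Set.mem_biUnion (x := T) (by simp [Finset.mem_powersetCard, hTc]) fun i hi => ?_
    simpa using hT hi
  refine (measureReal_mono hsub (measure_ne_top _ _)).trans ((measureReal_biUnion_finset_le _ _).trans ?_)
  calc _ ≤ ∑ T ∈ Finset.powersetCard (k + 1) (Finset.univ : Finset ι), q ^ (k + 1) := by
        refine Finset.sum_le_sum fun T hT => ?_
        have := measureReal_forall_mem_lt_le hX hq T
        rwa [(Finset.mem_powersetCard.1 hT).2] at this
    _ = ((Fintype.card ι).choose (k + 1) : ℝ) * q ^ (k + 1) := by
        simp [Finset.card_powersetCard]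
    _ ≤ _ := by
        gcongr
        exact_mod_cast Nat.choose_le_two_pow _ _

/-- For `|S| = s ≤ l` the block has `s(n+1-s) ≥ s(n+1-l)` entries, hence probability at most `y^s`.
There are at most `n^s · n^s` pairs, so each `s` contributes at most `(n²y)^s ≤ n²y`. -/
theorem measureReal_not_hall_le {Ω : Type*} [MeasurableSpace Ω] {P : Measure Ω} {l n : ℕ}
    (hln : l ≤ n) {X : Fin l → Fin n → Ω → ℝ}
    (hX : iIndepFun (fun p : Fin l × Fin n => X p.1 p.2) P) {t q : ℝ} (hq0 : 0 ≤ q)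
    (hq1 : q ≤ 1) (hq : ∀ i j, P.real {ω | X i j ω < t} ≤ q)
    (hsmall : (n : ℝ) ^ 2 * q ^ (n + 1 - l) ≤ 1) :
    P.real {ω | ∃ (S : Finset (Fin l)) (T : Finset (Fin n)), S.Nonempty ∧
        T.card + S.card = n + 1 ∧ ∀ i ∈ S, ∀ j ∈ T, X i j ω < t}
      ≤ n * ((n : ℝ) ^ 2 * q ^ (n + 1 - l)) := by
  classical
  have := hX.isProbabilityMeasure
  set y := q ^ (n + 1 - l) with hy
  have hy0 : 0 ≤ y := by positivity
  -- The value `0` at `s = 0` allows summing over all subsets by cardinality although the empty `S`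
  -- is excluded.
  let f : ℕ → ℝ := fun s => if s = 0 then 0 else (n : ℝ) ^ s * y ^ s
  let W : Finset (Finset (Fin l)) := Finset.univ.filter Finset.Nonempty
  have hsub : {ω | ∃ (S : Finset (Fin l)) (T : Finset (Fin n)), S.Nonempty ∧
        T.card + S.card = n + 1 ∧ ∀ i ∈ S, ∀ j ∈ T, X i j ω < t} ⊆
      ⋃ S ∈ W, ⋃ T ∈ Finset.powersetCard (n + 1 - S.card) (Finset.univ : Finset (Fin n)),
        {ω | ∀ p ∈ S ×ˢ T, X p.1 p.2 ω < t} := by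
    rintro ω ⟨S, T, hS, hST, h⟩
    refine Set.mem_biUnion (x := S) (by simpa [W] using hS)
      (Set.mem_biUnion (x := T) ?_ fun p hp => ?_)
    · simp [Finset.mem_powersetCard]; omega
    · rw [Finset.mem_product] at hp
      exact h _ hp.1 _ hp.2
  refine (measureReal_mono hsub (measure_ne_top _ _)).trans ((measureReal_biUnion_finset_le _ _).trans ?_)
  have hS : ∀ S ∈ W, P.real
      (⋃ T ∈ Finset.powersetCard (n + 1 - S.card) (Finset.univ : Finset (Fin n)),
        {ω | ∀ p ∈ S ×ˢ T, X p.1 p.2 ω < t}) ≤ f S.card := by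
    intro S hS
    have hS0 : 0 < S.card := Finset.card_pos.2 (by simpa [W] using hS)
    have hSl : S.card ≤ l := by simpa using Finset.card_le_univ S
    refine (measureReal_biUnion_finset_le _ _).trans ?_
    calc _ ≤ ∑ T ∈ Finset.powersetCard (n + 1 - S.card) (Finset.univ : Finset (Fin n)),
          y ^ S.card := by
          refine Finset.sum_le_sum fun T hT => ?_
          refine (measureReal_forall_mem_lt_le hX (fun p => hq p.1 p.2) (S ×ˢ T)).trans ?_
          rw [Finset.card_product, (Finset.mem_powersetCard.1 hT).2, hy, ← pow_mul]
          apply pow_le_pow_of_le_one hq0 hq1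
          rw [mul_comm]
          gcongr
      _ = (n.choose (n + 1 - S.card) : ℝ) * y ^ S.card := by
          simp [Finset.card_powersetCard]
      _ ≤ (n : ℝ) ^ S.card * y ^ S.card := by
          gcongr
          have h1 : n.choose (n + 1 - S.card) = n.choose (S.card - 1) := by
            rw [← Nat.choose_symm (by omega)]
            congr 1
            omega
          rw [h1]
          have h2 : n.choose (S.card - 1) ≤ n ^ (S.card - 1) := Nat.choose_le_pow _ _
          have h3 : n ^ (S.card - 1) ≤ n ^ S.card := Nat.pow_le_pow_right (by omega) (by omega)
          exact_mod_cast h2.trans h3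
      _ = f S.card := by simp only [f]; rw [if_neg (by omega)]
  calc _ ≤ ∑ S ∈ W, f S.card := Finset.sum_le_sum hS
    _ ≤ ∑ S ∈ (Finset.univ : Finset (Fin l)).powerset, f S.card := by
        apply Finset.sum_le_sum_of_subset_of_nonneg
        · intro S _; simp
        · intro S _ _
          simp only [f]
          split_ifs <;> positivity
    _ = ∑ s ∈ Finset.range (l + 1), (l.choose s : ℝ) * f s := by
        rw [Finset.sum_powerset_apply_card]; simp
    _ = ∑ s ∈ Finset.range l, (l.choose (s + 1) : ℝ) * f (s + 1) := by
        rw [Finset.sum_range_succ']; simp [f]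
    _ ≤ ∑ _s ∈ Finset.range l, (n : ℝ) ^ 2 * y := by
        refine Finset.sum_le_sum fun s _ => ?_
        have h1 : (l.choose (s + 1) : ℝ) ≤ (n : ℝ) ^ (s + 1) := by
          have h2 : l.choose (s + 1) ≤ l ^ (s + 1) := Nat.choose_le_pow _ _
          have h3 : l ^ (s + 1) ≤ n ^ (s + 1) := Nat.pow_le_pow_left hln _
          exact_mod_cast h2.trans h3
        calc (l.choose (s + 1) : ℝ) * f (s + 1)
            ≤ (n : ℝ) ^ (s + 1) * ((n : ℝ) ^ (s + 1) * y ^ (s + 1)) := by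
              simp only [f, if_neg (Nat.succ_ne_zero s)]
              gcongr
          _ = ((n : ℝ) ^ 2 * y) ^ (s + 1) := by ring
          _ ≤ (n : ℝ) ^ 2 * y := pow_le_of_le_one (by positivity) hsmall (by omega)
    _ ≤ n * ((n : ℝ) ^ 2 * y) := by
        rw [Finset.sum_const, Finset.card_range, nsmul_eq_mul]
        gcongr

theorem exists_pos_measureReal_lt_le {Ω : Type*} [MeasurableSpace Ω] {P : Measure Ω}
    [IsProbabilityMeasure P] {ξ : Ω → ℝ} (hξ : AEMeasurable ξ P) (hpos : ∀ᵐ ω ∂P, 0 < ξ ω)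
    {q : ℝ} (hq : 0 < q) : ∃ c : ℝ, 0 < c ∧ c ≤ 1 ∧ P.real {ω | ξ ω < c} ≤ q := by
  let s : ℕ → Set Ω := fun k => {ω | ξ ω < 1 / ((k : ℝ) + 1)}
  have hs : Tendsto (P ∘ s) atTop (𝓝 (P (⋂ k, s k))) := by
    apply tendsto_measure_iInter_atTop
    · intro k
      exact nullMeasurableSet_lt hξ aemeasurable_const
    · intro i j hij ω hω
      have hle : 1 / ((j : ℝ) + 1) ≤ 1 / ((i : ℝ) + 1) := by gcongr
      exact lt_of_lt_of_le (show ξ ω < 1 / ((j : ℝ) + 1) from hω) hle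
    · exact ⟨0, measure_ne_top _ _⟩
  have h0 : P (⋂ k, s k) = 0 := by
    refine measure_mono_null ?_ (ae_iff.1 hpos)
    intro ω hω hcon
    obtain ⟨k, hk⟩ := exists_nat_one_div_lt hcon
    exact absurd (Set.mem_iInter.1 hω k) (not_lt.2 hk.le)
  rw [h0] at hs
  obtain ⟨k, hk⟩ := (hs.eventually_lt_const (ENNReal.ofReal_pos.2 hq)).exists
  refine ⟨1 / ((k : ℝ) + 1), by positivity, ?_, ?_⟩
  · rw [div_le_one (by positivity)]
    linarith [Nat.cast_nonneg (α := ℝ) k]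
  · exact ENNReal.toReal_le_of_le_ofReal hq.le hk.le

/-- The surplus `b(1-ε) - a = 2δ` pays twice: one `δ m log n` absorbs `g^m`, the other the factor
`n^b` lost to the floor. -/
theorem eventually_exp_le_pow_mul_pow {m : ℕ → ℕ} (hm : ∀ᶠ n : ℕ in atTop, Real.log n ≤ m n)
    {a b g ε : ℝ} (hb : 0 ≤ b) (hab : a < b * (1 - ε)) (hg : 0 < g) :
    ∀ᶠ n : ℕ in atTop, Real.exp (a * m n * Real.log n)
      ≤ g ^ m n * ((n : ℝ) ^ b) ^ ⌊(1 - ε) * m n⌋₊ := by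
  have hlog : Tendsto (fun n : ℕ => Real.log n) atTop atTop :=
    Real.tendsto_log_atTop.comp tendsto_natCast_atTop_atTop
  set δ := (b * (1 - ε) - a) / 2 with hδ
  have hδ0 : 0 < δ := by rw [hδ]; linarith
  filter_upwards [hm, hlog.eventually_ge_atTop (-Real.log g / δ), hlog.eventually_ge_atTop (b / δ),
    eventually_gt_atTop 1] with n h1 h2 h3 h4
  have hn : (1 : ℝ) < n := by exact_mod_cast h4
  have hln := Real.log_pos hn
  rw [div_le_iff₀ hδ0] at h2 h3
  set l := ⌊(1 - ε) * (m n : ℝ)⌋₊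
  have hl : (1 - ε) * m n - 1 ≤ l := (Nat.sub_one_lt_floor _).le
  have key : g ^ m n * ((n : ℝ) ^ b) ^ l
      = Real.exp (m n * Real.log g + b * l * Real.log n) := by
    have e0 : (n : ℝ) ^ b = Real.exp (b * Real.log n) := by
      rw [Real.rpow_def_of_pos (by linarith), mul_comm]
    rw [Real.exp_add, Real.exp_nat_mul, Real.exp_log hg, e0, ← Real.exp_nat_mul]
    ring_nf
  rw [key, Real.exp_le_exp]
  have e1 : 0 ≤ m n * (Real.log g + Real.log n * δ) :=
    mul_nonneg (Nat.cast_nonneg _) (by linarith)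
  have e2 : 0 ≤ (m n * δ - b) * Real.log n :=
    mul_nonneg (by nlinarith) hln.le
  have e3 : b * ((1 - ε) * m n - 1) * Real.log n ≤ b * l * Real.log n := by gcongr
  have e4 : b * (1 - ε) = a + 2 * δ := by rw [hδ]; ring
  have e5 : b * ((1 - ε) * m n - 1) * Real.log n
      = (a + 2 * δ) * m n * Real.log n - b * Real.log n := by rw [← e4]; ring
  nlinarith

/-- This `q` is chosen so that `q^(εN/3) = (e^(-4)/2)^N`, which cancels the number `2^N` of subsets.
-/
theorem two_pow_mul_pow_floor_le {ε q : ℝ} (hε : 0 < ε) (hq : q = (Real.exp (-4) / 2) ^ (3 / ε))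
    (N : ℕ) : 2 ^ N * q ^ (⌊ε * N / 3⌋₊ + 1) ≤ Real.exp (-4 * N) := by
  have hw : (0 : ℝ) < Real.exp (-4) / 2 := by positivity
  have hw1 : Real.exp (-4) / 2 ≤ 1 := by
    have : Real.exp (-4) ≤ 1 := Real.exp_le_one_iff.2 (by norm_num)
    linarith
  have h1 : q ^ (⌊ε * N / 3⌋₊ + 1) ≤ (Real.exp (-4) / 2) ^ N := by
    rw [hq, ← Real.rpow_natCast, ← Real.rpow_mul hw.le, ← Real.rpow_natCast (n := N)]
    apply Real.rpow_le_rpow_of_exponent_ge hw hw1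
    have := (Nat.lt_floor_add_one (ε * N / 3)).le
    push_cast
    calc (N : ℝ) = 3 / ε * (ε * N / 3) := by field_simp
      _ ≤ _ := by gcongr
  calc _ ≤ 2 ^ N * (Real.exp (-4) / 2) ^ N := by gcongr
    _ = Real.exp (-4) ^ N := by rw [← mul_pow]; congr 1; ring
    _ = _ := by rw [← Real.exp_nat_mul]; ring_nf

/-! ### Almost sure bounds for the random matrices -/

section Matrices

variable {Ω₀ : Type*} [MeasurableSpace Ω₀] {P₀ : Measure Ω₀} {ξ : Ω₀ → ℝ} {m : ℕ → ℕ} {Ω : Type*} [MeasurableSpace Ω] {P : Measure Ω}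
  {A : (n : ℕ) → Ω → Matrix (Fin (m n)) (Fin n) ℝ}

theorem ProbabilityTheory.IdentDistrib.measureReal_setOf_lt_eq {X : Ω → ℝ} (h : IdentDistrib X ξ P P₀) (c : ℝ) :
    P.real {ω | X ω < c} = P₀.real {ω | ξ ω < c} := by
  have := h.measure_mem_eq (measurableSet_Iio (a := c))
  exact congrArg ENNReal.toReal this

theorem ae_forall_pos_of_identDistrib (hpos : ∀ᵐ ω ∂P₀, 0 < ξ ω)
    (hA : ∀ n i j, IdentDistrib (fun ω => A n ω i j) ξ P P₀) :
    ∀ᵐ ω ∂P, ∀ n i j, 0 < A n ω i j := by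
  refine ae_all_iff.2 fun n => ae_all_iff.2 fun i => ae_all_iff.2 fun j => ?_
  exact ((hA n i j).symm.ae_snd (p := fun x => 0 < x) measurableSet_Ioi hpos)

variable [IsProbabilityMeasure P₀] [IsProbabilityMeasure P]

/-- Columns are the critical case, having only `m n` entries: one fails with probability at most
`e^(-4m) ≤ n^(-4)`, which survives the union over `n` columns. -/
theorem ae_eventually_few_small (hmn : ∀ n, m n ≤ n)
    (hm : ∀ᶠ n : ℕ in atTop, Real.log n ≤ m n) (hξ : AEMeasurable ξ P₀)
    (hpos : ∀ᵐ ω ∂P₀, 0 < ξ ω)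
    (hind : ∀ n, iIndepFun (fun (p : Fin (m n) × Fin n) (ω : Ω) => A n ω p.1 p.2) P)
    (hA : ∀ n i j, IdentDistrib (fun ω => A n ω i j) ξ P P₀) {ε : ℝ} (hε : 0 < ε) :
    ∃ c : ℝ, 0 < c ∧ c ≤ 1 ∧ ∀ᵐ ω ∂P, ∀ᶠ n : ℕ in atTop,
      (∀ i, (Finset.univ.filter fun j => A n ω i j < c).card ≤ ⌊ε * n / 3⌋₊) ∧
      (∀ j, (Finset.univ.filter fun i => A n ω i j < c).card ≤ ⌊ε * m n / 3⌋₊) := by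
  set q : ℝ := (Real.exp (-4) / 2) ^ (3 / ε) with hq
  have hq0 : 0 < q := by positivity
  obtain ⟨c, hc0, hc1, hc⟩ := exists_pos_measureReal_lt_le hξ hpos hq0
  refine ⟨c, hc0, hc1, ?_⟩
  have hAc : ∀ n i j, P.real {ω | A n ω i j < c} ≤ q := fun n i j => by
    rw [(hA n i j).measureReal_setOf_lt_eq]; exact hc
  let bad : ℕ → Set Ω := fun n =>
    (⋃ i ∈ (Finset.univ : Finset (Fin (m n))),
      {ω | ⌊ε * n / 3⌋₊ < (Finset.univ.filter fun j => A n ω i j < c).card}) ∪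
    (⋃ j ∈ (Finset.univ : Finset (Fin n)),
      {ω | ⌊ε * m n / 3⌋₊ < (Finset.univ.filter fun i => A n ω i j < c).card})
  have hrow : ∀ n (i : Fin (m n)),
      P.real {ω | ⌊ε * n / 3⌋₊ < (Finset.univ.filter fun j => A n ω i j < c).card}
        ≤ Real.exp (-4 * n) := by
    intro n i
    have h := measureReal_card_lt_gt_le
      ((hind n).precomp (g := fun j : Fin n => (i, j)) (fun a b h => (Prod.mk.inj h).2))
      hq0.le (fun j => hAc n i j) ⌊ε * n / 3⌋₊
    rw [Fintype.card_fin] at h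
    exact h.trans (two_pow_mul_pow_floor_le hε hq n)
  have hcol : ∀ n (j : Fin n),
      P.real {ω | ⌊ε * m n / 3⌋₊ < (Finset.univ.filter fun i => A n ω i j < c).card}
        ≤ Real.exp (-4 * m n) := by
    intro n j
    have h := measureReal_card_lt_gt_le
      ((hind n).precomp (g := fun i : Fin (m n) => (i, j)) (fun a b h => (Prod.mk.inj h).1))
      hq0.le (fun i => hAc n i j) ⌊ε * m n / 3⌋₊
    rw [Fintype.card_fin] at h
    exact h.trans (two_pow_mul_pow_floor_le hε hq (m n))
  have hbad : ∀ᶠ n : ℕ in atTop, P.real (bad n) ≤ 2 * ((n : ℝ) ^ 2)⁻¹ := by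
    filter_upwards [hm, eventually_gt_atTop 0] with n h1 h2
    have hn : (1 : ℝ) ≤ n := by exact_mod_cast h2
    have hmn' : (m n : ℝ) ≤ n := by exact_mod_cast hmn n
    have e1 : Real.exp (-4 * m n) ≤ ((n : ℝ) ^ 4)⁻¹ := by
      calc Real.exp (-4 * m n) ≤ Real.exp (-(((4 : ℕ) : ℝ) * Real.log n)) := by
            apply Real.exp_le_exp.2; push_cast; linarith
        _ = _ := by rw [Real.exp_neg, Real.exp_nat_mul, Real.exp_log (by linarith)]
    calc P.real (bad n) ≤ m n * Real.exp (-4 * n) + n * Real.exp (-4 * m n) := by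
          refine (measureReal_union_le _ _).trans (add_le_add ?_ ?_)
          · refine (measureReal_biUnion_finset_le _ _).trans
              ((Finset.sum_le_sum fun i _ => hrow n i).trans ?_)
            simp
          · refine (measureReal_biUnion_finset_le _ _).trans
              ((Finset.sum_le_sum fun j _ => hcol n j).trans ?_)
            simp
      _ ≤ n * Real.exp (-4 * m n) + n * Real.exp (-4 * m n) := by
          have : Real.exp (-4 * n) ≤ Real.exp (-4 * m n) := Real.exp_le_exp.2 (by linarith)
          gcongr
      _ ≤ n * ((n : ℝ) ^ 4)⁻¹ + n * ((n : ℝ) ^ 4)⁻¹ := by gcongr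
      _ = 2 * ((n : ℝ) ^ 3)⁻¹ := by field_simp; ring
      _ ≤ 2 * ((n : ℝ) ^ 2)⁻¹ := by gcongr; norm_num
  filter_upwards [ae_eventually_notMem_of_le_inv_sq hbad] with ω hω
  filter_upwards [hω] with n hn
  simpa [bad, not_or] using hn

theorem floor_add_floor_add_floor_le {m n : ℕ} (hmn : m ≤ n) {ε : ℝ} (hε0 : 0 ≤ ε)
    (hε1 : ε ≤ 1) : ⌊ε * m / 3⌋₊ + ⌊ε * n / 3⌋₊ + ⌊(1 - ε) * m⌋₊ ≤ n := by
  have h1 : (⌊ε * m / 3⌋₊ : ℝ) ≤ ε * m / 3 := Nat.floor_le (by positivity)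
  have h2 : (⌊ε * n / 3⌋₊ : ℝ) ≤ ε * n / 3 := Nat.floor_le (by positivity)
  have h3 : (⌊(1 - ε) * m⌋₊ : ℝ) ≤ (1 - ε) * m :=
    Nat.floor_le (mul_nonneg (by linarith) (Nat.cast_nonneg _))
  have h4 : (m : ℝ) ≤ n := by exact_mod_cast hmn
  have h5 : (1 - 2 * ε / 3) * m ≤ (1 - 2 * ε / 3) * n :=
    mul_le_mul_of_nonneg_left h4 (by linarith)
  have : ((⌊ε * m / 3⌋₊ + ⌊ε * n / 3⌋₊ + ⌊(1 - ε) * m⌋₊ : ℕ) : ℝ) ≤ n := by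
    push_cast; nlinarith
  exact_mod_cast this

theorem floor_one_sub_mul_le (m : ℕ) {ε : ℝ} (hε0 : 0 ≤ ε) : ⌊(1 - ε) * m⌋₊ ≤ m := by
  apply Nat.floor_le_of_le
  nlinarith [Nat.cast_nonneg (α := ℝ) m]

theorem exists_one_sub_mul_gt {a b : ℝ} (hb : 0 < b) (hab : a < b) :
    ∃ ε : ℝ, 0 < ε ∧ ε < 1 ∧ a < b * (1 - ε) := by
  refine ⟨min (1 / 2) ((b - a) / (2 * b)), ?_, ?_, ?_⟩
  · have : 0 < b - a := by linarith
    positivity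
  · exact (min_le_left _ _).trans_lt (by norm_num)
  · have h1 : b * min (1 / 2) ((b - a) / (2 * b)) ≤ b * ((b - a) / (2 * b)) := by
      gcongr; exact min_le_right _ _
    have h2 : b * ((b - a) / (2 * b)) = (b - a) / 2 := by field_simp
    linarith

theorem ae_eventually_rectPermanent_ge_of_lt_one (hmn : ∀ n, m n ≤ n)
    (hm : ∀ᶠ n : ℕ in atTop, Real.log n ≤ m n) (hξ : AEMeasurable ξ P₀)
    (hpos : ∀ᵐ ω ∂P₀, 0 < ξ ω)
    (hind : ∀ n, iIndepFun (fun (p : Fin (m n) × Fin n) (ω : Ω) => A n ω p.1 p.2) P)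
    (hA : ∀ n i j, IdentDistrib (fun ω => A n ω i j) ξ P P₀) {a : ℝ} (ha : a < 1) :
    ∀ᵐ ω ∂P, ∀ᶠ n : ℕ in atTop,
      Real.exp (a * m n * Real.log n) ≤ rectPermanent (A n ω) := by
  obtain ⟨ε, hε0, hε1, hε⟩ := exists_one_sub_mul_gt one_pos ha
  obtain ⟨c, hc0, hc1, hc⟩ := ae_eventually_few_small hmn hm hξ hpos hind hA hε0
  have hg : 0 < ε * c / 3 := by positivity
  filter_upwards [hc, ae_forall_pos_of_identDistrib hpos hA] with ω hω hAω
  filter_upwards [hω, eventually_exp_le_pow_mul_pow hm zero_le_one hε hg] with n hn hexp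
  have hA0 : ∀ i j, 0 ≤ A n ω i j := fun i j => (hAω n i j).le
  refine hexp.trans ?_
  set l := ⌊(1 - ε) * (m n : ℝ)⌋₊
  have hlm : l ≤ m n := floor_one_sub_mul_le (m n) hε0.le
  have hlln := floor_add_floor_add_floor_le (hmn n) hε0.le hε1.le
  have hp1 := rectPermanent_ge_of_few_small hlm (hmn n) hA0 hc0.le hn.1 hn.2 hlln
  -- Of the `n` columns, `l` are reserved for the chosen rows and at most `εn/3` are small in a
  -- given row; what is left is still at least `εn/3`.
  obtain ⟨d, hd⟩ : ∃ d : ℕ, d + l + ⌊ε * n / 3⌋₊ = n := ⟨n - l - ⌊ε * n / 3⌋₊, by omega⟩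
  have hp2 : (d * c) ^ l ≤ rectPermanent ((A n ω).submatrix (Fin.castLE hlm) id) := by
    refine rectPermanent_ge_of_many_large (fun i j => hA0 _ _) hc0.le fun i => ?_
    have h1 := hn.1 (Fin.castLE hlm i)
    have h2 := Finset.card_filter_add_card_filter_not (s := (Finset.univ : Finset (Fin n)))
      (fun j => A n ω (Fin.castLE hlm i) j < c)
    simp only [not_lt, Finset.card_univ, Fintype.card_fin] at h2
    simp only [id]
    omega
  have hd' : ε * n / 3 ≤ d := by
    have e1 : (⌊ε * n / 3⌋₊ : ℝ) ≤ ε * n / 3 := Nat.floor_le (by positivity)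
    have e2 : (l : ℝ) ≤ (1 - ε) * m n :=
      Nat.floor_le (mul_nonneg (by linarith) (Nat.cast_nonneg _))
    have e3 : (d : ℝ) + l + ⌊ε * n / 3⌋₊ = n := by exact_mod_cast hd
    have e4 : (1 - ε) * (m n : ℝ) ≤ (1 - ε) * n :=
      mul_le_mul_of_nonneg_left (by exact_mod_cast hmn n) (by linarith)
    nlinarith [mul_nonneg hε0.le (Nat.cast_nonneg (α := ℝ) n)]
  calc (ε * c / 3) ^ m n * ((n : ℝ) ^ (1 : ℝ)) ^ l
      = (ε * c / 3) ^ (m n - l) * (ε * n / 3 * c) ^ l := by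
        rw [Real.rpow_one, ← Nat.sub_add_cancel hlm, pow_add, mul_assoc, ← mul_pow,
          Nat.add_sub_cancel]
        congr 2
        ring
    _ ≤ c ^ (m n - l) * (d * c) ^ l := by
        gcongr
        nlinarith
    _ ≤ c ^ (m n - l) * rectPermanent ((A n ω).submatrix (Fin.castLE hlm) id) := by gcongr
    _ ≤ _ := hp1

theorem eventually_pow_mul_exp_neg_rpow_le_one (k : ℕ) {ε κ : ℝ} (hε : 0 < ε) (hκ : 0 < κ) :
    ∀ᶠ n : ℕ in atTop, (n : ℝ) ^ k * Real.exp (-ε * (n : ℝ) ^ κ) ≤ 1 := by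
  have h1 := tendsto_rpow_mul_exp_neg_mul_atTop_nhds_zero (k / κ) ε hε
  have h2 : Tendsto (fun n : ℕ => (n : ℝ) ^ κ) atTop atTop :=
    (tendsto_rpow_atTop hκ).comp tendsto_natCast_atTop_atTop
  filter_upwards [(h1.comp h2).eventually_lt_const one_pos] with n hn
  have h3 : ((n : ℝ) ^ κ) ^ (k / κ) = (n : ℝ) ^ k := by
    rw [← Real.rpow_mul (Nat.cast_nonneg _), mul_div_cancel₀ _ hκ.ne', Real.rpow_natCast]
  simp only [Function.comp, h3] at hn
  exact hn.le

theorem ae_eventually_rectPermanent_ge_of_lt_tail (hmn : ∀ n, m n ≤ n)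
    (hm : ∀ᶠ n : ℕ in atTop, Real.log n ≤ m n) (hξ : AEMeasurable ξ P₀)
    (hpos : ∀ᵐ ω ∂P₀, 0 < ξ ω) {β : ℝ} (hβ : 0 < β)
    (htail : Tendsto (fun t : ℝ => Real.log (P₀.real {ω | t ≤ ξ ω}) / Real.log t)
      atTop (𝓝 (-(1 / β))))
    (hind : ∀ n, iIndepFun (fun (p : Fin (m n) × Fin n) (ω : Ω) => A n ω p.1 p.2) P)
    (hA : ∀ n i j, IdentDistrib (fun ω => A n ω i j) ξ P P₀) {a : ℝ} (ha : a < β) :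
    ∀ᵐ ω ∂P, ∀ᶠ n : ℕ in atTop,
      Real.exp (a * m n * Real.log n) ≤ rectPermanent (A n ω) := by
  -- Taking `b` above `max a 0` keeps it positive even when `a` is negative.
  obtain ⟨b, hab, hbβ⟩ := exists_between (max_lt ha hβ)
  have hb : 0 < b := (le_max_right _ _).trans_lt hab
  obtain ⟨ε, hε0, hε1, hε⟩ := exists_one_sub_mul_gt hb ((le_max_left _ _).trans_lt hab)
  -- `r > 1/β` gives the tail bound `P(ξ ≥ t) ≥ t^(-r)` for large `t`; `br < 1` makes the expected
  -- number `n · n^(-br)` of entries `≥ n^b` in a row diverge.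
  obtain ⟨r, hr1, hr2⟩ := exists_between (one_div_lt_one_div_of_lt hb hbβ)
  have hκ : 0 < 1 - b * r := by
    rw [lt_div_iff₀ hb] at hr2
    linarith
  obtain ⟨c, hc0, hc1, hc⟩ := ae_eventually_few_small hmn hm hξ hpos hind hA hε0
  let l : ℕ → ℕ := fun n => ⌊(1 - ε) * (m n : ℝ)⌋₊
  have hlm : ∀ n, l n ≤ m n := fun n => floor_one_sub_mul_le (m n) hε0.le
  let bad : ℕ → Set Ω := fun n => {ω | ∃ (S : Finset (Fin (l n))) (T : Finset (Fin n)),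
    S.Nonempty ∧ T.card + S.card = n + 1 ∧
      ∀ i ∈ S, ∀ j ∈ T, A n ω (Fin.castLE (hlm n) i) j < (n : ℝ) ^ b}
  have hbad : ∀ᶠ n : ℕ in atTop, P.real (bad n) ≤ 1 * ((n : ℝ) ^ 2)⁻¹ := by
    have ht : Tendsto (fun n : ℕ => (n : ℝ) ^ b) atTop atTop :=
      (tendsto_rpow_atTop hb).comp tendsto_natCast_atTop_atTop
    have hlow := ht.eventually (eventually_rpow_le_of_tendsto_log_div_log
      (fun _ => measureReal_nonneg) htail (neg_lt_neg hr1)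
      (neg_lt_zero.2 (one_div_pos.2 hβ)))
    filter_upwards [hlow, eventually_pow_mul_exp_neg_rpow_le_one 5 hε0 hκ,
      eventually_gt_atTop 0] with n h1 h2 h3
    have hn : (1 : ℝ) ≤ n := by exact_mod_cast h3
    have hn0 : (0 : ℝ) < n := by linarith
    -- From `1 - x ≤ e^(-x)` with `x = n^(-br)`.
    set q := Real.exp (-(n : ℝ) ^ (-(b * r))) with hq
    have hq1 : q ≤ 1 := Real.exp_le_one_iff.2 (neg_nonpos.2 (by positivity))
    have hqA : ∀ i j, P.real {ω | A n ω i j < (n : ℝ) ^ b} ≤ q := by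
      intro i j
      rw [(hA n i j).measureReal_setOf_lt_eq]
      have hcompl : {ω | ξ ω < (n : ℝ) ^ b} = {ω | (n : ℝ) ^ b ≤ ξ ω}ᶜ := by ext; simp
      rw [hcompl, probReal_compl_eq_one_sub₀ (nullMeasurableSet_le aemeasurable_const hξ)]
      rw [← Real.rpow_mul hn0.le] at h1
      have e1 := Real.add_one_le_exp (-(n : ℝ) ^ (-(b * r)))
      have e2 : b * -r = -(b * r) := by ring
      rw [e2] at h1
      linarith
    have hqpow : q ^ (n + 1 - l n) ≤ Real.exp (-ε * (n : ℝ) ^ (1 - b * r)) := by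
      rw [hq, ← Real.exp_nat_mul, Real.exp_le_exp]
      have hln : l n ≤ n := (hlm n).trans (hmn n)
      have e1 : (l n : ℝ) ≤ (1 - ε) * m n :=
        Nat.floor_le (mul_nonneg (by linarith) (Nat.cast_nonneg _))
      have e2 : (1 - ε) * (m n : ℝ) ≤ (1 - ε) * n :=
        mul_le_mul_of_nonneg_left (by exact_mod_cast hmn n) (by linarith)
      have e3 : ε * n ≤ ((n + 1 - l n : ℕ) : ℝ) := by
        rw [Nat.cast_sub (by omega)]; push_cast; linarith
      have e4 : (n : ℝ) ^ (1 - b * r) = n * (n : ℝ) ^ (-(b * r)) := by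
        rw [sub_eq_add_neg, Real.rpow_add hn0, Real.rpow_one]
      rw [e4]
      have e5 : (0 : ℝ) ≤ (n : ℝ) ^ (-(b * r)) := by positivity
      nlinarith [mul_le_mul_of_nonneg_right e3 e5]
    have hbd : (n : ℝ) ^ 5 * q ^ (n + 1 - l n) ≤ 1 := le_trans (by gcongr) h2
    have hq0 : 0 ≤ q ^ (n + 1 - l n) := by positivity
    have hinj : Function.Injective fun p : Fin (l n) × Fin n => (Fin.castLE (hlm n) p.1, p.2) :=
      (Fin.castLE_injective (hlm n)).prodMap Function.injective_id
    have hmain := measureReal_not_hall_le (X := fun i j ω => A n ω (Fin.castLE (hlm n) i) j)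
      ((hlm n).trans (hmn n)) ((hind n).precomp hinj)
      (t := (n : ℝ) ^ b) (Real.exp_pos _).le hq1 (fun i j => hqA _ j)
      (le_trans (mul_le_mul_of_nonneg_right (pow_le_pow_right₀ hn (by norm_num)) hq0) hbd)
    refine hmain.trans ?_
    rw [one_mul, ← one_div, le_div_iff₀ (by positivity)]
    calc _ = (n : ℝ) ^ 5 * q ^ (n + 1 - l n) := by ring
      _ ≤ 1 := hbd
  filter_upwards [hc, ae_forall_pos_of_identDistrib hpos hA,
    ae_eventually_notMem_of_le_inv_sq hbad] with ω hω hAω hHall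
  filter_upwards [hω, hHall, eventually_exp_le_pow_mul_pow hm hb.le hε hc0] with n hn hnH hexp
  have hA0 : ∀ i j, 0 ≤ A n ω i j := fun i j => (hAω n i j).le
  refine hexp.trans ?_
  have hp1 := rectPermanent_ge_of_few_small (hlm n) (hmn n) hA0 hc0.le hn.1 hn.2
    (floor_add_floor_add_floor_le (hmn n) hε0.le hε1.le)
  have hp2 : ((n : ℝ) ^ b) ^ l n
      ≤ rectPermanent ((A n ω).submatrix (Fin.castLE (hlm n)) id) := by
    refine rectPermanent_ge_of_hall (fun i j => hA0 _ _) (by positivity) fun S T hS hST => ?_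
    by_contra! hcon
    exact hnH ⟨S, T, hS, hST, hcon⟩
  refine le_trans ?_ hp1
  exact mul_le_mul (pow_le_pow_of_le_one hc0.le hc1 (Nat.sub_le _ _)) hp2 (by positivity)
    (by positivity)

theorem ae_eventually_rectPermanent_lt (hm : ∀ᶠ n : ℕ in atTop, Real.log n ≤ m n)
    (hξ : AEMeasurable ξ P₀) (hpos : ∀ᵐ ω ∂P₀, 0 < ξ ω) {β : ℝ} (hβ : 0 < β)
    (htail : Tendsto (fun t : ℝ => Real.log (P₀.real {ω | t ≤ ξ ω}) / Real.log t)
      atTop (𝓝 (-(1 / β))))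
    (hind : ∀ n, iIndepFun (fun (p : Fin (m n) × Fin n) (ω : Ω) => A n ω p.1 p.2) P)
    (hA : ∀ n i j, IdentDistrib (fun ω => A n ω i j) ξ P P₀) {b : ℝ} (hb : max 1 β < b) :
    ∀ᵐ ω ∂P, ∀ᶠ n : ℕ in atTop,
      rectPermanent (A n ω) < Real.exp (b * m n * Real.log n) := by
  have hM : 0 < max 1 β := lt_max_of_lt_left one_pos
  have hb0 : 0 < b := hM.trans hb
  -- `s ≤ 1` is for subadditivity, `s < 1/β` for a finite moment, and `bs > 1` for decay.
  obtain ⟨s, hs1, hs2⟩ := exists_between (one_div_lt_one_div_of_lt hM hb)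
  have hs0 : 0 < s := (one_div_pos.2 hb0).trans hs1
  have hs_one : s ≤ 1 := hs2.le.trans ((div_le_one hM).2 (le_max_left _ _))
  have hsβ : s < 1 / β := hs2.trans_le (one_div_le_one_div_of_le hβ (le_max_right _ _))
  have hκ : 0 < b * s - 1 := by
    rw [div_lt_iff₀ hb0] at hs1
    linarith
  obtain ⟨r, hsr, hrβ⟩ := exists_between hsβ
  have hfin := lintegral_rpow_lt_top_of_tail hξ hpos hs0 hsr
    (eventually_le_rpow_of_tendsto_log_div_log (fun _ => measureReal_nonneg) htail
      (neg_lt_neg hrβ))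
  set K := ∫⁻ ω, ENNReal.ofReal (ξ ω) ^ s ∂P₀ with hK
  have hKfin : K ≠ ⊤ := by
    refine ne_of_lt (lt_of_le_of_lt (le_of_eq ?_) hfin)
    refine lintegral_congr_ae (hpos.mono fun ω h => ?_)
    exact ENNReal.ofReal_rpow_of_pos h
  have hAK : ∀ n i j, ∫⁻ ω, ENNReal.ofReal (A n ω i j) ^ s ∂P = K := fun n i j =>
    ((hA n i j).comp (ENNReal.measurable_ofReal.pow_const s)).lintegral_eq
  have hbad : ∀ᶠ n : ℕ in atTop,
      P.real {ω | Real.exp (b * m n * Real.log n) ≤ rectPermanent (A n ω)}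
        ≤ 1 * ((n : ℝ) ^ 2)⁻¹ := by
    have hlim : Tendsto (fun n : ℕ => K.toReal * (n : ℝ) ^ (-(b * s - 1))) atTop (𝓝 0) := by
      simpa using ((tendsto_rpow_neg_atTop hκ).comp tendsto_natCast_atTop_atTop).const_mul K.toReal
    filter_upwards [hm, hlim.eventually_lt_const (Real.exp_pos (-2)), eventually_gt_atTop 0]
      with n h1 h2 h3
    have hn0 : (0 : ℝ) < n := by exact_mod_cast h3
    have hmain := rpow_mul_measure_le_rectPermanent (hind n)
      (fun i j => (hA n i j).aemeasurable_fst)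
      ((ae_forall_pos_of_identDistrib hpos hA).mono fun ω h i j => (h n i j).le) hs0 hs_one
      (hAK n) (Real.exp (b * m n * Real.log n))
    have hreal : Real.exp (b * m n * Real.log n) ^ s *
        P.real {ω | Real.exp (b * m n * Real.log n) ≤ rectPermanent (A n ω)}
          ≤ (n * K.toReal) ^ m n := by
      have := ENNReal.toReal_mono (ENNReal.pow_ne_top
        (ENNReal.mul_ne_top (ENNReal.natCast_ne_top n) hKfin)) hmain
      rw [ENNReal.toReal_mul, ← ENNReal.toReal_rpow, ENNReal.toReal_ofReal (Real.exp_pos _).le,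
        ENNReal.toReal_pow, ENNReal.toReal_mul, ENNReal.toReal_natCast] at this
      exact this
    have e1 : Real.exp (b * m n * Real.log n) ^ s = ((n : ℝ) ^ (b * s)) ^ m n := by
      rw [← Real.rpow_natCast, ← Real.rpow_mul hn0.le, Real.rpow_def_of_pos hn0, ← Real.exp_mul]
      ring_nf
    have e2 : (n * K.toReal) ^ m n
        = ((n : ℝ) ^ (b * s)) ^ m n * (K.toReal * (n : ℝ) ^ (-(b * s - 1))) ^ m n := by
      rw [← mul_pow, mul_left_comm, ← Real.rpow_add hn0, mul_comm]
      ring_nf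
      simp
    rw [e1, e2] at hreal
    have e3 := le_of_mul_le_mul_left hreal (by positivity)
    calc _ ≤ (K.toReal * (n : ℝ) ^ (-(b * s - 1))) ^ m n := e3
      _ ≤ Real.exp (-2) ^ m n := by gcongr
      _ = Real.exp (-2 * m n) := by rw [← Real.exp_nat_mul]; ring_nf
      _ ≤ Real.exp (-(((2 : ℕ) : ℝ) * Real.log n)) := by
          apply Real.exp_le_exp.2; push_cast; linarith
      _ = 1 * ((n : ℝ) ^ 2)⁻¹ := by
          rw [Real.exp_neg, Real.exp_nat_mul, Real.exp_log hn0, one_mul]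
  filter_upwards [ae_eventually_notMem_of_le_inv_sq hbad] with ω hω
  filter_upwards [hω] with n hn
  simpa using hn

end Matrices

/-! ### Conclusion -/

theorem eventually_log_le_of_one_lt_liminf {m : ℕ → ℕ}
    (h : (1 : EReal) < liminf
      (fun n : ℕ =>
        (((m n : ℝ) * Real.log (Real.log (n : ℝ)) / (Real.log (n : ℝ)) ^ 2 : ℝ) : EReal)) atTop) :
    ∀ᶠ n : ℕ in atTop, Real.log n ≤ m n := by
  have hlog : Tendsto (fun n : ℕ => Real.log n) atTop atTop :=
    Real.tendsto_log_atTop.comp tendsto_natCast_atTop_atTop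
  filter_upwards [eventually_lt_of_lt_liminf h, hlog.eventually_gt_atTop 1] with n h1 h2
  have h3 : 1 < (m n : ℝ) * Real.log (Real.log n) / (Real.log n) ^ 2 := by exact_mod_cast h1
  rw [lt_div_iff₀ (by positivity), one_mul] at h3
  have h4 : Real.log (Real.log n) ≤ Real.log n := Real.log_le_self (by linarith)
  have h5 : (m n : ℝ) * Real.log (Real.log n) ≤ m n * Real.log n := by gcongr
  nlinarith

theorem mainTheorem3
    -- the positive random variable `ξ` with tail exponent `-1 / β`
    {Ω₀ : Type*} [MeasurableSpace Ω₀] (P₀ : Measure Ω₀) [IsProbabilityMeasure P₀]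
    (ξ : Ω₀ → ℝ) (hξ_meas : AEMeasurable ξ P₀) (hξ_pos : ∀ᵐ ω ∂P₀, 0 < ξ ω)
    (β : ℝ) (hβ : 0 < β)
    (hξ_tail : Tendsto (fun t : ℝ => Real.log (P₀.real {ω | t ≤ ξ ω}) / Real.log t)
      atTop (𝓝 (-(1 / β))))
    -- the heights; the lower limit is taken in the extended reals, as it may be infinite
    (m : ℕ → ℕ) (hm : ∀ n, m n ≤ n)
    (hm_liminf : (1 : EReal) < liminf
      (fun n : ℕ =>
        (((m n : ℝ) * Real.log (Real.log (n : ℝ)) / (Real.log (n : ℝ)) ^ 2 : ℝ) : EReal)) atTop)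
    -- the matrices: for each `n` the entries are iid copies of `ξ`;
    -- nothing is assumed on the joint law of matrices with different `n`
    {Ω : Type*} [MeasurableSpace Ω] (P : Measure Ω) [IsProbabilityMeasure P]
    (A : (n : ℕ) → Ω → Matrix (Fin (m n)) (Fin n) ℝ)
    (hA_indep : ∀ n, iIndepFun (fun (p : Fin (m n) × Fin n) (ω : Ω) => A n ω p.1 p.2) P)
    (hA_ident : ∀ n i j, IdentDistrib (fun ω => A n ω i j) ξ P P₀) :
    ∀ᵐ ω ∂P, Tendsto
      (fun n : ℕ => Real.log (rectPermanent (A n ω)) / ((m n : ℝ) * Real.log (n : ℝ)))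
      atTop (𝓝 (max 1 β)) := by
  have hm_log := eventually_log_le_of_one_lt_liminf hm_liminf
  have hlow : ∀ a < max 1 β, ∀ᵐ ω ∂P, ∀ᶠ n : ℕ in atTop,
      Real.exp (a * m n * Real.log n) ≤ rectPermanent (A n ω) := by
    intro a ha
    rcases lt_max_iff.1 ha with ha | ha
    · exact ae_eventually_rectPermanent_ge_of_lt_one hm hm_log hξ_meas hξ_pos hA_indep hA_ident ha
    · exact ae_eventually_rectPermanent_ge_of_lt_tail hm hm_log hξ_meas hξ_pos hβ hξ_tail
        hA_indep hA_ident ha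
  have hup : ∀ b, max 1 β < b → ∀ᵐ ω ∂P, ∀ᶠ n : ℕ in atTop,
      rectPermanent (A n ω) < Real.exp (b * m n * Real.log n) := fun b hb =>
    ae_eventually_rectPermanent_lt hm_log hξ_meas hξ_pos hβ hξ_tail hA_indep hA_ident hb
  -- The exceptional null set depends on the exponent, so only countably many exponents are used.
  obtain ⟨u, -, hu, hu_lim⟩ := exists_seq_strictMono_tendsto (max 1 β)
  obtain ⟨v, -, hv, hv_lim⟩ := exists_seq_strictAnti_tendsto (max 1 β)
  filter_upwards [ae_all_iff.2 fun k => hlow (u k) (hu k), ae_all_iff.2 fun k => hup (v k) (hv k)]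
    with ω h1 h2
  have hlog : ∀ᶠ n : ℕ in atTop, 0 < (m n : ℝ) * Real.log n := by
    filter_upwards [hm_log, eventually_gt_atTop 1] with n hn hn1
    have : 0 < Real.log n := Real.log_pos (by exact_mod_cast hn1)
    exact mul_pos (this.trans_le hn) this
  refine tendsto_order.2 ⟨fun a ha => ?_, fun b hb => ?_⟩
  · obtain ⟨k, hk⟩ := (hu_lim.eventually_const_lt ha).exists
    filter_upwards [h1 k, hlog] with n hn h0
    refine hk.trans_le ((le_div_iff₀ h0).2 ?_)
    rw [← mul_assoc]
    exact (Real.le_log_iff_exp_le ((Real.exp_pos _).trans_le hn)).2 hn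
  · obtain ⟨k, hk⟩ := (hv_lim.eventually_lt_const hb).exists
    -- The lower bound `h1 0` serves only to make the permanent positive before taking logarithms.
    filter_upwards [h1 0, h2 k, hlog] with n hn0 hn h0
    refine lt_of_le_of_lt ((div_le_iff₀ h0).2 ?_) hk
    rw [← mul_assoc]
    exact ((Real.log_lt_iff_lt_exp ((Real.exp_pos _).trans_le hn0)).2 hn).le
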